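/- Let $G=(V,E)$ be a finite connected graph, possibly with parallel edges and loops. Let $\mathbb E$ be the set of oriented edges: each edge gives two oriented edges $e,\bar e$ in opposite directions. Let $C^1(G,\mathbb R)$ be the space of functions $x:\mathbb E\to\mathbb R$ with $x_{\bar e}=-x_e$, with the quadratic form $q(x)=\sum x_e^2$, where the sum takes one of $e,\bar e$ for each edge. For $f:V\to\mathbb R$ let $d(f)\in C^1(G,\mathbb R)$ be given by $d(f)_e=f(\text{head of }e)-f(\text{tail of }e)$. Let $\mathrm K=d(\mathbb R^V)$ be the cut space and $L=d(\mathbb Z^V)\subset \mathrm K$ the lattice of integer cuts. The covering number $\mathrm{Cov}(L)$ is the smallest real number $r$ such that for every $x\in \mathrm K$ there is $m\in L$ with $q(x-m)\le r$. Let $\Delta$ be the Laplacian, $\Delta(f)(y)=\sum (f(y)-f(z))$, the sum being over all edges joining $y$ to a vertex $z$ (with multiplicity), and $\langle f,g\rangle=\sum_{y\in V} f(y)g(y)$. An acyclic orientation $D$ of $G$ is a choice of one of the two directions for every edge that is not a loop, such that there is no oriented cycle (loops, which play no role for cuts, are left unoriented). Write $d^{\mathrm{in}}_y,d^{\mathrm{out}}_y$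 for the in- and out-degrees in $D$. For every acyclic orientation $D$ the equation $2\Delta(f_D)=d^{\mathrm{in}}-d^{\mathrm{out}}$ has a solution $f_D:V\to\mathbb R$, and $\langle f_D,\Delta(f_D)\rangle$ does not depend on the solution. An acyclic orientation $D$ of $G$ is called well-unbalanced if it maximizes $\langle f_D,\Delta(f_D)\rangle$ among all acyclic orientations of $G$; such orientations exist. Then for every well-unbalanced acyclic orientation $D$ of $G$, $$\mathrm{Cov}(L)=\langle f_D,\Delta(f_D)\rangle .$$ In particular, if $G$ is bipartite, then $\mathrm{Cov}(L)=\frac{|E|}{4}$. -/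

import Mathlib

/-- A graph with vertex set `V`, possibly with parallel edges and loops, given by its set `A` of
oriented edges: every edge gives two oriented edges `e` and `bar e` in opposite directions. -/
structure OrGraph (V A : Type*) where
  tail : A → V
  head : A → V
  bar : A → A
  bar_bar : ∀ e, bar (bar e) = e
  bar_ne : ∀ e, bar e ≠ e
  tail_bar : ∀ e, tail (bar e) = head e

/-- `r` is the covering number of the lattice `L` in the real vector space `E` with quadratic form
`q`: the smallest real number such that every point `x` has a lattice point `m` with
`q (x - m) ≤ r`. -/
def IsCoveringNumber {E : Type*} [AddCommGroup E] [Module ℝ E] (q : QuadraticForm ℝ E)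
    (L : AddSubgroup E) (r : ℝ) : Prop :=
  IsLeast {r : ℝ | ∀ x : E, ∃ m ∈ L, q (x - m) ≤ r} r

namespace OrGraph

variable {V A : Type*} (G : OrGraph V A)

theorem head_bar (e : A) : G.head (G.bar e) = G.tail e := by
  rw [← G.tail_bar, G.bar_bar]

/-- Any two vertices are joined by a path (and there is a vertex). -/
def Connected : Prop :=
  Nonempty V ∧ ∀ u v : V, Relation.ReflTransGen (fun x y => ∃ e, G.tail e = x ∧ G.head e = y) u v

/-- The vertices split into two classes such that every edge joins the two classes. -/
def Bipartite : Prop :=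
  ∃ X : Set V, ∀ e, G.tail e ∈ X ↔ G.head e ∉ X

/-- The number of (unoriented) edges: an edge is an unordered pair `{e, bar e}`. -/
noncomputable def numEdges : ℕ := (Set.range fun e => s(e, G.bar e)).ncard

/-- `C¹(G, R)`: functions on oriented edges with `g (bar e) = - g e`. -/
def C1 (R : Type*) [CommRing R] : Submodule R (A → R) where
  carrier := {g | ∀ e, g (G.bar e) = - g e}
  add_mem' := by
    intro a b ha hb e
    simp only [Pi.add_apply, ha e, hb e]
    ring
  zero_mem' := by
    intro e
    simp
  smul_mem' := by
    intro c a ha e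
    simp [ha e]

/-- The differential `d : C⁰(G, R) → C¹(G, R)`, `d f e = f (head e) - f (tail e)`. -/
def d (R : Type*) [CommRing R] : (V → R) →ₗ[R] G.C1 R where
  toFun f := ⟨fun e => f (G.head e) - f (G.tail e), fun e => by
    simp only [G.head_bar, G.tail_bar, neg_sub]⟩
  map_add' f g := by
    ext e
    simp only [Pi.add_apply, Submodule.coe_add]
    ring
  map_smul' c f := by
    ext e
    simp only [Pi.smul_apply, smul_eq_mul, RingHom.id_apply, Submodule.coe_smul]
    ring

theorem d_apply (R : Type*) [CommRing R] (f : V → R) (e : A) :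
    (G.d R f).1 e = f (G.head e) - f (G.tail e) := rfl

/-- The inclusion of `C¹(G, ℤ)` in `C¹(G, ℝ)`. -/
def castC1 : G.C1 ℤ →+ G.C1 ℝ where
  toFun g := ⟨fun e => (g.1 e : ℝ), fun e => by
    have h := g.2 e
    simp only [h, Int.cast_neg]⟩
  map_zero' := by
    ext e
    simp
  map_add' g h := by
    ext e
    simp

theorem castC1_apply (g : G.C1 ℤ) (e : A) : (G.castC1 g).1 e = (g.1 e : ℝ) := rfl

/-- The real cut space `K = im (d : C⁰(G, ℝ) → C¹(G, ℝ))`. -/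
def cutSpace : Submodule ℝ (G.C1 ℝ) := LinearMap.range (G.d ℝ)

/-- The image of `d : C⁰(G, ℤ) → C¹(G, ℤ)`, inside `C¹(G, ℝ)`. -/
def integerCuts : AddSubgroup (G.C1 ℝ) := (LinearMap.range (G.d ℤ)).toAddSubgroup.map G.castC1

theorem integerCuts_le : G.integerCuts ≤ G.cutSpace.toAddSubgroup := by
  rintro _ ⟨_, ⟨f, rfl⟩, rfl⟩
  refine ⟨fun v => (f v : ℝ), ?_⟩
  ext e
  simp [d, castC1]

/-- The lattice of integer cuts, as a subgroup of the cut space (in which `integerCuts` is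
contained). -/
def cutLattice : AddSubgroup G.cutSpace := G.integerCuts.addSubgroupOf G.cutSpace.toAddSubgroup

section Finite

variable [Fintype A]

/-- The inner product on `C¹(G, ℝ)` for which the unoriented edges, each with an arbitrary
direction, form an orthonormal basis; the factor `1 / 2` is there because every unoriented edge
occurs twice in the sum. -/
noncomputable def edgeInner : LinearMap.BilinForm ℝ (G.C1 ℝ) :=
  LinearMap.mk₂ ℝ (fun x y => (1 / 2 : ℝ) * ∑ e, x.1 e * y.1 e)
    (fun x x' y => by
      simp only [Submodule.coe_add, Pi.add_apply, add_mul, Finset.sum_add_distrib, mul_add])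
    (fun c x y => by
      simp only [Submodule.coe_smul, Pi.smul_apply, smul_eq_mul, Finset.mul_sum]
      exact Finset.sum_congr rfl fun e _ => by ring)
    (fun x y y' => by
      simp only [Submodule.coe_add, Pi.add_apply, Finset.sum_add_distrib, mul_add])
    (fun c x y => by
      simp only [Submodule.coe_smul, Pi.smul_apply, smul_eq_mul, Finset.mul_sum]
      exact Finset.sum_congr rfl fun e _ => by ring)

/-- The quadratic form `q x = ⟨x, x⟩` restricted to the cut space. -/
noncomputable def cutForm : QuadraticForm ℝ G.cutSpace :=
  (LinearMap.BilinMap.toQuadraticMap G.edgeInner).comp G.cutSpace.subtype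

/-- The graph Laplacian: `Δ f y` is the sum of `f y - f z` over all edges from `y` to `z`. -/
def laplacian [DecidableEq V] (f : V → ℝ) (y : V) : ℝ :=
  ∑ e with G.tail e = y, (f y - f (G.head e))

/-- The quantity `⟨f, Δ f⟩`. -/
def energy [Fintype V] [DecidableEq V] (f : V → ℝ) : ℝ := ∑ y, f y * G.laplacian f y

end Finite

/-- `D` is an acyclic orientation of the graph: it contains exactly one of `e` and `bar e` for
every edge which is not a loop, and no oriented cycle (no closed directed walk of positive length).
In particular it contains no loops: loops are left unoriented, as they play no role for cuts. -/
def IsAcyclicOrientation (D : Finset A) : Prop :=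
  (∀ e, G.tail e ≠ G.head e → (G.bar e ∈ D ↔ e ∉ D)) ∧
  ∀ v, ¬ Relation.TransGen (fun x y => ∃ e ∈ D, G.tail e = x ∧ G.head e = y) v v

/-- The in-degree of `y` in `D`. -/
def inDeg [DecidableEq V] (D : Finset A) (y : V) : ℕ := {e ∈ D | G.head e = y}.card

/-- The out-degree of `y` in `D`. -/
def outDeg [DecidableEq V] (D : Finset A) (y : V) : ℕ := {e ∈ D | G.tail e = y}.card

/-- `f` is a solution `f_D` of the Laplacian equation `2 Δ f = d^in - d^out`. -/
def IsPotential [Fintype A] [DecidableEq V] (D : Finset A) (f : V → ℝ) : Prop :=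
  ∀ y, 2 * G.laplacian f y = (G.inDeg D y : ℝ) - (G.outDeg D y : ℝ)

/-- The acyclic orientation `D` is well-unbalanced: it maximizes `⟨f_D, Δ f_D⟩` among all acyclic
orientations. -/
def IsWellUnbalanced [Fintype V] [Fintype A] [DecidableEq V] (D : Finset A) : Prop :=
  G.IsAcyclicOrientation D ∧ ∃ f, G.IsPotential D f ∧
    ∀ D' f', G.IsAcyclicOrientation D' → G.IsPotential D' f' → G.energy f' ≤ G.energy f

end OrGraph

/-! The covering number of a lattice is the maximum of `q` on its Voronoi cell. If `D` is an
acyclic orientation, `d f_D` is the orthogonal projection to the cut space of the cochain equal to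
`1 / 2` on the edges of `D`, so `2 ⟨d f_D, d n⟩` is the sum of `d n` over `D`. For integral `n`
this is at most `q (d n)`, because `k ≤ k ^ 2` for integers: `d f_D` lies in the Voronoi cell.

Conversely, let `d f` lie in the Voronoi cell and choose an acyclic orientation `D` along which
`f` is nondecreasing. The Voronoi inequalities `2 ⟨d f, d 1_S⟩ ≤ q (d 1_S)` of the cuts extend, by
writing a function as a nonnegative combination of the indicators of its superlevel sets, to
`2 ⟨d f, d g⟩ ≤ ‖d g‖₁` for all `g`. Taking `g = f` yields
`2 q (d f) ≤ ‖d f‖₁ = 2 ⟨d f_D, d f⟩`, and `q (d f) ≤ q (d f_D)` follows. -/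

section Lattice

variable {E : Type*} [AddCommGroup E] [Module ℝ E]

/-- The Voronoi cell of the origin: the points for which the origin is a closest point of the
lattice `L`, where distances are measured by the quadratic form `q`. -/
def voronoiCell (q : QuadraticForm ℝ E) (L : AddSubgroup E) : Set E :=
  {x | ∀ m ∈ L, q x ≤ q (x - m)}

theorem sub_mem_voronoiCell {q : QuadraticForm ℝ E} {L : AddSubgroup E} {x m : E} (hm : m ∈ L)
    (h : ∀ m' ∈ L, q (x - m) ≤ q (x - m')) : x - m ∈ voronoiCell q L := fun m' hm' => by
  rw [sub_sub]
  exact h _ (add_mem hm hm')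

theorem IsCoveringNumber.of_isGreatest_voronoiCell {q : QuadraticForm ℝ E} {L : AddSubgroup E}
    {r : ℝ} (hclosest : ∀ x, ∃ m ∈ L, x - m ∈ voronoiCell q L)
    (hr : IsGreatest (q '' voronoiCell q L) r) : IsCoveringNumber q L r := by
  obtain ⟨⟨x₀, hx₀, rfl⟩, hmax⟩ := hr
  refine ⟨fun x => ?_, fun s hs => ?_⟩
  · obtain ⟨m, hm, hcell⟩ := hclosest x
    exact ⟨m, hm, hmax ⟨_, hcell, rfl⟩⟩
  · obtain ⟨m, hm, hle⟩ := hs x₀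
    exact (hx₀ m hm).trans hle

end Lattice

theorem tendsto_sum_sq_sub_intCast {ι : Type*} [Fintype ι] (x : ι → ℝ) :
    Filter.Tendsto (fun m : ι → ℤ => ∑ i, (x i - m i) ^ 2) Filter.cofinite Filter.atTop := by
  refine Filter.tendsto_atTop.2 fun r => Filter.eventually_cofinite.2 ?_
  refine (Set.Finite.pi' fun i => Set.finite_Icc ⌈x i - √r⌉ ⌊x i + √r⌋).subset fun m hm i => ?_
  have hi : (x i - m i) ^ 2 ≤ r :=
    (Finset.single_le_sum (fun j _ => sq_nonneg (x j - m j)) (Finset.mem_univ i)).trans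
      (not_le.1 hm).le
  have habs := abs_le.1 (Real.abs_le_sqrt hi)
  exact ⟨Int.ceil_le.2 (by linarith), Int.le_floor.2 (by linarith)⟩

theorem nonneg_induction_indicator {ι R : Type*} [Finite ι] [AddCommGroup R] [LinearOrder R]
    [IsOrderedAddMonoid R] {P : (ι → R) → Prop} (zero : P 0)
    (add_indicator : ∀ (g : ι → R) (c : R) (S : Set ι), 0 ≤ g → 0 ≤ c → g.support ⊆ S → P g →
      P (g + S.indicator fun _ => c)) {g : ι → R} (hg : 0 ≤ g) : P g := by
  induction hk : g.support.ncard using Nat.strong_induction_on generalizing g with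
  | _ k ih =>
    rcases g.support.eq_empty_or_nonempty with hempty | hne
    · rwa [Function.support_eq_empty_iff.1 hempty]
    obtain ⟨i, hi, hmin⟩ := Set.exists_min_image _ g g.support.toFinite hne
    set g' : ι → R := g - g.support.indicator fun _ => g i with hg'
    have hin : ∀ j ∈ g.support, g' j = g j - g i := fun j hj => by
      rw [hg', Pi.sub_apply, Set.indicator_of_mem hj]
    have hout : ∀ j ∉ g.support, g' j = 0 := fun j hj => by
      rw [hg', Pi.sub_apply, Set.indicator_of_notMem hj, Function.notMem_support.1 hj, sub_zero]
    have hnonneg : 0 ≤ g' := fun j => by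
      by_cases hj : j ∈ g.support
      · simpa [hin j hj] using hmin j hj
      · exact (hout j hj).ge
    have hsub : g'.support ⊆ g.support := fun j hj => by_contra fun hj' => hj (hout j hj')
    have hssub : g'.support ⊂ g.support :=
      ⟨hsub, fun h => h hi (by rw [hin i hi, sub_self])⟩
    have hlt : g'.support.ncard < k := hk ▸ Set.ncard_lt_ncard hssub
    simpa [hg'] using add_indicator g' (g i) g.support hnonneg (hg i) hsub (ih _ hlt hnonneg rfl)

section BilinForm

variable {E : Type*} [AddCommGroup E]

theorem bilinForm_surjective_of_anisotropic {K : Type*} [Field K] [Module K E]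
    [FiniteDimensional K E] {B : LinearMap.BilinForm K E}
    (hB : (LinearMap.BilinMap.toQuadraticMap B).Anisotropic) : Function.Surjective B := by
  have hinj : Function.Injective B := (injective_iff_map_eq_zero B).2 fun x hx =>
    hB x (by rw [LinearMap.BilinMap.toQuadraticMap_apply, hx, LinearMap.zero_apply])
  exact (LinearMap.injective_iff_surjective_of_finrank_eq_finrank
    Subspace.dual_finrank_eq.symm).1 hinj

variable {R : Type*} [CommRing R] [Module R E] {B : LinearMap.BilinForm R E}

theorem bilinForm_apply_sub_self (hB : B.IsSymm) (x y : E) :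
    B (x - y) (x - y) = B x x - 2 * B x y + B y y := by
  rw [map_sub, map_sub, LinearMap.sub_apply, LinearMap.sub_apply, hB.eq y x]
  ring

theorem bilinForm_apply_self_le_of_le_apply [LinearOrder R] [IsStrictOrderedRing R]
    (hB : B.IsPosSemidef) {x y : E} (h : B x x ≤ B y x) : B x x ≤ B y y := by
  have hnonneg := hB.nonneg (y - x)
  rw [bilinForm_apply_sub_self hB.isSymm] at hnonneg
  linarith

end BilinForm

namespace OrGraph

variable {V A : Type*} (G : OrGraph V A)

/-- The differential `d` with values in the cut space. -/
def toCut : (V → ℝ) →ₗ[ℝ] G.cutSpace := (G.d ℝ).rangeRestrict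

theorem toCut_surjective : Function.Surjective G.toCut := (G.d ℝ).surjective_rangeRestrict

theorem toCut_apply (f : V → ℝ) (e : A) : (G.toCut f).1.1 e = f (G.head e) - f (G.tail e) := rfl

theorem mem_cutLattice_iff {m : G.cutSpace} :
    m ∈ G.cutLattice ↔ ∃ n : V → ℤ, G.toCut (fun v => (n v : ℝ)) = m := by
  have hcast (n : V → ℤ) : G.castC1 (G.d ℤ n) = (G.toCut fun v => (n v : ℝ)).1 := by
    ext e
    simp [castC1_apply, d_apply, toCut_apply]
  constructor
  · rintro ⟨_, ⟨n, rfl⟩, h⟩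
    exact ⟨n, Subtype.ext ((hcast n).symm.trans h)⟩
  · rintro ⟨n, rfl⟩
    exact ⟨_, ⟨n, rfl⟩, hcast n⟩

theorem sum_comp_bar [Fintype A] {M : Type*} [AddCommMonoid M] (w : A → M) :
    ∑ e, w (G.bar e) = ∑ e, w e :=
  Equiv.sum_comp (Function.Involutive.toPerm G.bar G.bar_bar) w

section AcyclicOrientation

/-- The edges along which `κ` increases. If `κ` separates adjacent vertices, this is an acyclic
orientation. -/
def increasingEdges [Fintype A] {α : Type*} [LinearOrder α] (κ : V → α) : Finset A :=
  {e | κ (G.tail e) < κ (G.head e)}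

theorem mem_increasingEdges [Fintype A] {α : Type*} [LinearOrder α] {κ : V → α} {e : A} :
    e ∈ G.increasingEdges κ ↔ κ (G.tail e) < κ (G.head e) := by
  simp [increasingEdges]

theorem isAcyclicOrientation_increasingEdges [Fintype A] {α : Type*} [LinearOrder α] {κ : V → α}
    (hκ : ∀ e, G.tail e ≠ G.head e → κ (G.tail e) ≠ κ (G.head e)) :
    G.IsAcyclicOrientation (G.increasingEdges κ) := by
  refine ⟨fun e he => ?_, fun v hv => ?_⟩
  · rw [mem_increasingEdges, mem_increasingEdges, G.tail_bar, G.head_bar, not_lt]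
    exact ⟨le_of_lt, fun h => h.lt_of_ne (hκ e he).symm⟩
  · have hlt : Relation.TransGen (· < ·) (κ v) (κ v) := hv.lift κ <| by
      rintro _ _ ⟨e, he, rfl, rfl⟩
      exact G.mem_increasingEdges.1 he
    rw [Relation.transGen_eq_self] at hlt
    exact lt_irrefl _ hlt

theorem exists_isAcyclicOrientation_monotone [Finite A] {α : Type*} [LinearOrder α] (f : V → α) :
    ∃ D : Finset A, G.IsAcyclicOrientation D ∧ ∀ e ∈ D, f (G.tail e) ≤ f (G.head e) := by
  cases nonempty_fintype A
  -- Ties of `f` are broken by an arbitrary linear order on the vertices.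
  obtain ⟨_, -⟩ := exists_wellFoundedLT V
  let κ : V → α ×ₗ V := fun v => toLex (f v, v)
  have hκ : Function.Injective κ := fun u v h => congrArg (fun p => (ofLex p).2) h
  exact ⟨G.increasingEdges κ, G.isAcyclicOrientation_increasingEdges fun e he => hκ.ne he,
    fun e he => Prod.Lex.monotone_fst_ofLex (G.mem_increasingEdges.1 he).le⟩

variable {G} {D : Finset A}

theorem IsAcyclicOrientation.sum_univ_eq_two_mul_sum [Fintype A] (hD : G.IsAcyclicOrientation D)
    {R : Type*} [CommSemiring R] {w : A → R} (hbar : ∀ e, w (G.bar e) = w e)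
    (hloop : ∀ e, G.tail e = G.head e → w e = 0) : ∑ e, w e = 2 * ∑ e ∈ D, w e := by
  classical
  let wD : A → R := fun e => if e ∈ D then w e else 0
  have hwD : ∑ e, wD e = ∑ e ∈ D, w e := by simp [wD]
  have hwD_bar : ∑ e, wD (G.bar e) = ∑ e ∈ D, w e := (G.sum_comp_bar wD).trans hwD
  have hsplit : ∀ e, w e = wD e + wD (G.bar e) := fun e => by
    by_cases he : G.tail e = G.head e
    · simp [wD, hbar, hloop e he]
    · by_cases hm : e ∈ D <;> simp [wD, hbar, hD.1 e he, hm]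
  rw [Finset.sum_congr rfl fun e _ => hsplit e, Finset.sum_add_distrib, hwD, hwD_bar, two_mul]

theorem IsAcyclicOrientation.card_eq_numEdges (hD : G.IsAcyclicOrientation D)
    (hloop : ∀ e, G.tail e ≠ G.head e) : D.card = G.numEdges := by
  have hbar : ∀ e, G.bar e ∈ D ↔ e ∉ D := fun e => hD.1 e (hloop e)
  have hinj : Set.InjOn (fun e => s(e, G.bar e)) (D : Set A) := fun a ha b hb hab => by
    rcases Sym2.eq_iff.1 hab with h | h
    · exact h.1
    · exact ((hbar b).1 (h.1 ▸ ha) hb).elim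
  have himage : Set.range (fun e => s(e, G.bar e)) = (fun e => s(e, G.bar e)) '' (D : Set A) := by
    refine (Set.range_subset_iff.2 fun e => ?_).antisymm (Set.image_subset_range _ _)
    by_cases he : e ∈ D
    · exact ⟨e, he, rfl⟩
    · exact ⟨G.bar e, (hbar e).2 he, by simp only [G.bar_bar, Sym2.eq_swap]⟩
  rw [numEdges, himage, hinj.ncard_image, Set.ncard_coe_finset]

end AcyclicOrientation

section EdgeSum

/-- The linear form on cochains that sums the values over a set of oriented edges. -/
def edgeSum (D : Finset A) : G.C1 ℝ →ₗ[ℝ] ℝ :=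
  ∑ e ∈ D, LinearMap.proj e ∘ₗ (G.C1 ℝ).subtype

theorem edgeSum_apply (D : Finset A) (x : G.C1 ℝ) : G.edgeSum D x = ∑ e ∈ D, x.1 e := by
  simp [edgeSum]

theorem inDeg_sub_outDeg [DecidableEq V] (D : Finset A) (y : V) : (G.inDeg D y : ℝ) - G.outDeg D y =
    ∑ e ∈ D, ((Pi.single y 1 : V → ℝ) (G.head e) - (Pi.single y 1 : V → ℝ) (G.tail e)) := by
  simp [inDeg, outDeg, Pi.single_apply, Finset.sum_sub_distrib]

end EdgeSum

variable [Fintype A]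

section DirichletForm

theorem edgeInner_apply (x y : G.C1 ℝ) : G.edgeInner x y = 1 / 2 * ∑ e, x.1 e * y.1 e := rfl

theorem edgeInner_anisotropic :
    (LinearMap.BilinMap.toQuadraticMap G.edgeInner).Anisotropic := fun x hx => by
  have hsum : ∑ e, x.1 e * x.1 e = 0 := by
    rw [LinearMap.BilinMap.toQuadraticMap_apply, edgeInner_apply] at hx
    linarith
  ext e
  exact mul_self_eq_zero.1 <|
    (Finset.sum_eq_zero_iff_of_nonneg fun e _ => mul_self_nonneg (x.1 e)).1 hsum e
      (Finset.mem_univ e)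

/-- The Dirichlet form `⟨d f, d g⟩`, which is also `⟨f, Δ g⟩`. -/
noncomputable def dirichletForm : LinearMap.BilinForm ℝ (V → ℝ) :=
  G.edgeInner.compl₁₂ (G.d ℝ) (G.d ℝ)

theorem dirichletForm_apply (f g : V → ℝ) :
    G.dirichletForm f g =
      1 / 2 * ∑ e, (f (G.head e) - f (G.tail e)) * (g (G.head e) - g (G.tail e)) := rfl

theorem cutForm_toCut (f : V → ℝ) : G.cutForm (G.toCut f) = G.dirichletForm f f := rfl

theorem isPosSemidef_dirichletForm : G.dirichletForm.IsPosSemidef where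
  eq f g := by simp only [dirichletForm_apply, mul_comm]
  nonneg f := mul_nonneg (by norm_num) (Finset.sum_nonneg fun _ _ => mul_self_nonneg _)

variable {G} in
theorem IsAcyclicOrientation.dirichletForm_eq_sum {D : Finset A} (hD : G.IsAcyclicOrientation D)
    (f g : V → ℝ) : G.dirichletForm f g =
      ∑ e ∈ D, (f (G.head e) - f (G.tail e)) * (g (G.head e) - g (G.tail e)) := by
  rw [dirichletForm_apply, hD.sum_univ_eq_two_mul_sum
    (fun e => by simp only [G.head_bar, G.tail_bar]; ring) fun e he => by simp [he]]
  ring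

end DirichletForm

section Potential

section Degree

variable [DecidableEq V]

theorem dirichletForm_single_one (f : V → ℝ) (y : V) :
    G.dirichletForm f (Pi.single y 1) = G.laplacian f y := by
  have htail : ∑ e, (if G.tail e = y then f (G.tail e) - f (G.head e) else 0) =
      G.laplacian f y := by
    rw [laplacian, Finset.sum_filter]
    exact Finset.sum_congr rfl fun e _ => ite_congr rfl (fun h => by rw [h]) fun _ => rfl
  have hhead : ∑ e, (if G.head e = y then f (G.head e) - f (G.tail e) else 0) =
      G.laplacian f y := by
    rw [← htail, ← G.sum_comp_bar]
    simp only [G.head_bar, G.tail_bar]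
  have hterm (e : A) :
      (f (G.head e) - f (G.tail e)) *
          ((Pi.single y 1 : V → ℝ) (G.head e) - (Pi.single y 1 : V → ℝ) (G.tail e)) =
        (if G.head e = y then f (G.head e) - f (G.tail e) else 0) +
          if G.tail e = y then f (G.tail e) - f (G.head e) else 0 := by
    simp only [Pi.single_apply]
    split_ifs <;> ring
  rw [dirichletForm_apply, Finset.sum_congr rfl fun e _ => hterm e, Finset.sum_add_distrib, hhead,
    htail]
  ring

theorem energy_eq_dirichletForm [Fintype V] (f : V → ℝ) : G.energy f = G.dirichletForm f f := by
  have hf : ∑ y, f y • (Pi.single y 1 : V → ℝ) = f := by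
    simp only [← Pi.single_smul, smul_eq_mul, mul_one, Finset.univ_sum_single]
  conv_rhs => rw [← hf, map_sum, hf]
  simp only [map_smul, dirichletForm_single_one, smul_eq_mul, energy]

theorem isPotential_iff_forall_single {D : Finset A} {f : V → ℝ} : G.IsPotential D f ↔
    ∀ y, 2 * G.dirichletForm f (Pi.single y 1) = G.edgeSum D (G.d ℝ (Pi.single y 1)) := by
  simp only [IsPotential, inDeg_sub_outDeg, dirichletForm_single_one, edgeSum_apply, d_apply]

theorem exists_isPotential (D : Finset A) : ∃ f, G.IsPotential D f := by
  have hsurj : Function.Surjective (G.edgeInner.restrict G.cutSpace) :=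
    bilinForm_surjective_of_anisotropic (E := G.cutSpace) fun x hx =>
      Subtype.ext (G.edgeInner_anisotropic x.1 hx)
  obtain ⟨x, hx⟩ := hsurj ((G.edgeSum D).domRestrict G.cutSpace)
  obtain ⟨f, rfl⟩ := G.toCut_surjective x
  refine ⟨(1 / 2 : ℝ) • f, G.isPotential_iff_forall_single.2 fun y => ?_⟩
  have hf : G.dirichletForm f (Pi.single y 1) = G.edgeSum D (G.d ℝ (Pi.single y 1)) :=
    LinearMap.congr_fun hx (G.toCut (Pi.single y 1))
  rw [map_smul, LinearMap.smul_apply, hf, smul_eq_mul]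
  ring

end Degree

variable {G} [DecidableEq V] {D : Finset A} {f : V → ℝ}

theorem isPotential_iff_forall [Finite V] : G.IsPotential D f ↔
    ∀ g, 2 * G.dirichletForm f g = ∑ e ∈ D, (g (G.head e) - g (G.tail e)) := by
  rw [isPotential_iff_forall_single]
  refine ⟨fun h g => ?_, fun h y => (h _).trans ?_⟩
  · have hsingle : (2 : ℝ) • G.dirichletForm f = G.edgeSum D ∘ₗ G.d ℝ :=
      LinearMap.pi_ext' fun y => LinearMap.ext_ring (h y)
    exact (LinearMap.congr_fun hsingle g).trans (G.edgeSum_apply D _)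
  · exact (G.edgeSum_apply D (G.d ℝ (Pi.single y 1))).symm

theorem IsPotential.energy_eq [Fintype V] {f' : V → ℝ} (hf : G.IsPotential D f)
    (hf' : G.IsPotential D f') : G.energy f = G.energy f' := by
  have hform : ∀ g, G.dirichletForm f g = G.dirichletForm f' g := fun g =>
    mul_left_cancel₀ two_ne_zero <|
      (isPotential_iff_forall.1 hf g).trans (isPotential_iff_forall.1 hf' g).symm
  calc G.energy f = G.dirichletForm f f := G.energy_eq_dirichletForm f
    _ = G.dirichletForm f' f := hform f
    _ = G.dirichletForm f f' := G.isPosSemidef_dirichletForm.isSymm.eq f' f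
    _ = G.dirichletForm f' f' := hform f'
    _ = G.energy f' := (G.energy_eq_dirichletForm f').symm

end Potential

section VoronoiCell

theorem toCut_mem_voronoiCell_iff {f : V → ℝ} :
    G.toCut f ∈ voronoiCell G.cutForm G.cutLattice ↔ ∀ n : V → ℤ,
      2 * G.dirichletForm f (fun v => (n v : ℝ)) ≤
        G.dirichletForm (fun v => (n v : ℝ)) fun v => (n v : ℝ) := by
  have hsub (n : V → ℤ) : G.cutForm (G.toCut f - G.toCut fun v => (n v : ℝ)) =
      G.dirichletForm f f - 2 * G.dirichletForm f (fun v => (n v : ℝ)) +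
        G.dirichletForm (fun v => (n v : ℝ)) fun v => (n v : ℝ) := by
    have hmap := map_sub G.toCut f fun v => (n v : ℝ)
    exact (congrArg G.cutForm hmap).symm.trans <|
      bilinForm_apply_sub_self G.isPosSemidef_dirichletForm.isSymm _ _
  constructor
  · intro h n
    have hn := h _ (G.mem_cutLattice_iff.2 ⟨n, rfl⟩)
    rw [hsub, cutForm_toCut] at hn
    linarith
  · intro h m hm
    obtain ⟨n, rfl⟩ := G.mem_cutLattice_iff.1 hm
    rw [hsub, cutForm_toCut]
    linarith [h n]

theorem exists_sub_mem_voronoiCell (x : G.cutSpace) :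
    ∃ m ∈ G.cutLattice, x - m ∈ voronoiCell G.cutForm G.cutLattice := by
  let δ (n : V → ℤ) (e : A) : ℤ := n (G.head e) - n (G.tail e)
  have hdist (n : V → ℤ) : G.cutForm (x - G.toCut fun v => (n v : ℝ)) =
      1 / 2 * ∑ e, (x.1.1 e - δ n e) ^ 2 := by
    change 1 / 2 * ∑ e, (x.1.1 e - _) * (x.1.1 e - _) = _
    simp [toCut_apply, δ, sq]
  obtain ⟨_, ⟨n, rfl⟩, hn⟩ :=
    (tendsto_sum_sq_sub_intCast x.1.1).exists_within_forall_le (Set.range_nonempty δ)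
  have hmem := G.mem_cutLattice_iff.2 ⟨n, rfl⟩
  refine ⟨_, hmem, sub_mem_voronoiCell hmem fun m hm => ?_⟩
  obtain ⟨k, rfl⟩ := G.mem_cutLattice_iff.1 hm
  rw [hdist, hdist]
  linarith [hn (δ k) ⟨k, rfl⟩]

variable {G} {f : V → ℝ}

theorem IsPotential.toCut_mem_voronoiCell [Finite V] [DecidableEq V] {D : Finset A}
    (hf : G.IsPotential D f) (hD : G.IsAcyclicOrientation D) :
    G.toCut f ∈ voronoiCell G.cutForm G.cutLattice := by
  rw [toCut_mem_voronoiCell_iff]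
  intro n
  rw [isPotential_iff_forall.1 hf, hD.dirichletForm_eq_sum]
  refine Finset.sum_le_sum fun e _ => ?_
  rw [← sq]
  exact_mod_cast Int.le_self_sq (n (G.head e) - n (G.tail e))

end VoronoiCell

section Variation

/-- The `ℓ¹` norm of `d g`, in which every edge is counted once. -/
noncomputable def variation (g : V → ℝ) : ℝ := 1 / 2 * ∑ e, |g (G.head e) - g (G.tail e)|

theorem variation_indicator_one (S : Set V) :
    G.variation (S.indicator 1) = G.dirichletForm (S.indicator 1) (S.indicator 1) := by
  classical
  rw [variation, dirichletForm_apply]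
  congr 1
  refine Finset.sum_congr rfl fun e _ => ?_
  by_cases hhead : G.head e ∈ S <;> by_cases htail : G.tail e ∈ S <;> simp [hhead, htail]

theorem variation_add_smul_indicator_one {g : V → ℝ} {c : ℝ} {S : Set V} (hg : 0 ≤ g)
    (hc : 0 ≤ c) (hS : g.support ⊆ S) :
    G.variation (g + c • S.indicator 1) = G.variation g + c * G.variation (S.indicator 1) := by
  have hout : ∀ v ∉ S, g v = 0 := fun v hv => Function.notMem_support.1 fun h => hv (hS h)
  have habs (v : V) : |g v + c| = |g v| + c := by
    rw [abs_of_nonneg (hg v), abs_of_nonneg (add_nonneg (hg v) hc)]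
  have hterm (e : A) :
      |(g + c • S.indicator 1 : V → ℝ) (G.head e) - (g + c • S.indicator 1 : V → ℝ) (G.tail e)| =
        |g (G.head e) - g (G.tail e)| +
          c * |(S.indicator 1 : V → ℝ) (G.head e) - (S.indicator 1 : V → ℝ) (G.tail e)| := by
    by_cases hhead : G.head e ∈ S <;> by_cases htail : G.tail e ∈ S
    · simp [hhead, htail]
    · simp [hhead, htail, hout _ htail, habs]
    · simp [hhead, htail, hout _ hhead, habs, -neg_add_rev]
    · simp [hhead, htail, hout _ hhead, hout _ htail]
  simp only [variation, hterm, Finset.sum_add_distrib, ← Finset.mul_sum]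
  ring

variable {G}

theorem IsAcyclicOrientation.variation_eq_sum {D : Finset A} (hD : G.IsAcyclicOrientation D)
    {f : V → ℝ} (hf : ∀ e ∈ D, f (G.tail e) ≤ f (G.head e)) :
    G.variation f = ∑ e ∈ D, (f (G.head e) - f (G.tail e)) := by
  rw [variation, hD.sum_univ_eq_two_mul_sum (w := fun e => |f (G.head e) - f (G.tail e)|)
    (fun e => by rw [G.head_bar, G.tail_bar, abs_sub_comm]) fun e he => by simp [he],
    Finset.sum_congr rfl fun e he => abs_of_nonneg (sub_nonneg.2 (hf e he))]
  ring

theorem two_mul_dirichletForm_le_variation_of_nonneg [Finite V] {f g : V → ℝ}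
    (hf : G.toCut f ∈ voronoiCell G.cutForm G.cutLattice) (hg : 0 ≤ g) :
    2 * G.dirichletForm f g ≤ G.variation g := by
  classical
  have hcut (S : Set V) : 2 * G.dirichletForm f (S.indicator 1) ≤ G.variation (S.indicator 1) := by
    have hcast : (fun v => ((S.indicator (1 : V → ℤ) v : ℤ) : ℝ)) = S.indicator 1 := by
      ext v
      by_cases hv : v ∈ S <;> simp [hv]
    rw [variation_indicator_one]
    simpa only [hcast] using G.toCut_mem_voronoiCell_iff.1 hf (S.indicator 1)
  refine nonneg_induction_indicator (P := fun g => 2 * G.dirichletForm f g ≤ G.variation g)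
    (by simp [variation]) (fun g c S hg hc hS ih => ?_) hg
  have hsmul : (S.indicator fun _ => c) = c • S.indicator (1 : V → ℝ) := by
    ext v
    simp [Set.indicator_apply]
  rw [hsmul, map_add, map_smul, smul_eq_mul, G.variation_add_smul_indicator_one hg hc hS]
  linarith [mul_le_mul_of_nonneg_left (hcut S) hc]

theorem two_mul_dirichletForm_le_variation [Finite V] {f : V → ℝ}
    (hf : G.toCut f ∈ voronoiCell G.cutForm G.cutLattice) (g : V → ℝ) :
    2 * G.dirichletForm f g ≤ G.variation g := by
  obtain ⟨c, hc⟩ := (Set.finite_range g).bddBelow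
  have hshift : 0 ≤ fun v => g v - c := fun v => sub_nonneg.2 (hc ⟨v, rfl⟩)
  simpa [dirichletForm_apply, variation] using
    two_mul_dirichletForm_le_variation_of_nonneg hf hshift

theorem exists_dirichletForm_self_le_energy [Fintype V] [DecidableEq V] {f : V → ℝ}
    (hf : G.toCut f ∈ voronoiCell G.cutForm G.cutLattice) : ∃ (D : Finset A) (h : V → ℝ),
      G.IsAcyclicOrientation D ∧ G.IsPotential D h ∧ G.dirichletForm f f ≤ G.energy h := by
  obtain ⟨D, hD, hmono⟩ := G.exists_isAcyclicOrientation_monotone f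
  obtain ⟨h, hh⟩ := G.exists_isPotential D
  have hle : 2 * G.dirichletForm f f ≤ 2 * G.dirichletForm h f :=
    calc 2 * G.dirichletForm f f ≤ G.variation f := two_mul_dirichletForm_le_variation hf f
      _ = ∑ e ∈ D, (f (G.head e) - f (G.tail e)) := hD.variation_eq_sum hmono
      _ = 2 * G.dirichletForm h f := (isPotential_iff_forall.1 hh f).symm
  refine ⟨D, h, hD, hh, ?_⟩
  rw [energy_eq_dirichletForm]
  exact bilinForm_apply_self_le_of_le_apply G.isPosSemidef_dirichletForm (by linarith)

end Variation

section WellUnbalanced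

variable [Fintype V] [DecidableEq V]

theorem exists_isWellUnbalanced : ∃ D, G.IsWellUnbalanced D := by
  choose F hF using G.exists_isPotential
  obtain ⟨D₀, hD₀, -⟩ := G.exists_isAcyclicOrientation_monotone (0 : V → ℝ)
  obtain ⟨D, hD, hmax⟩ := Set.exists_max_image {D | G.IsAcyclicOrientation D}
    (fun D => G.energy (F D)) (Set.toFinite _) ⟨D₀, hD₀⟩
  refine ⟨D, hD, F D, hF D, fun D' f' hD' hf' => ?_⟩
  rw [hf'.energy_eq (hF D')]
  exact hmax D' hD'

variable {G} {D : Finset A} {f : V → ℝ}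

theorem IsWellUnbalanced.isGreatest_energy (hD : G.IsWellUnbalanced D) (hf : G.IsPotential D f) :
    IsGreatest (G.cutForm '' voronoiCell G.cutForm G.cutLattice) (G.energy f) := by
  obtain ⟨hac, f₀, hf₀, hmax⟩ := hD
  refine ⟨⟨G.toCut f, hf.toCut_mem_voronoiCell hac, (G.energy_eq_dirichletForm f).symm⟩, ?_⟩
  rintro _ ⟨x, hx, rfl⟩
  obtain ⟨g, rfl⟩ := G.toCut_surjective x
  obtain ⟨D', h, hD', hh, hle⟩ := exists_dirichletForm_self_le_energy hx
  rw [hf.energy_eq hf₀]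
  exact hle.trans (hmax D' h hD' hh)

theorem IsWellUnbalanced.isCoveringNumber_energy (hD : G.IsWellUnbalanced D)
    (hf : G.IsPotential D f) : IsCoveringNumber G.cutForm G.cutLattice (G.energy f) :=
  .of_isGreatest_voronoiCell G.exists_sub_mem_voronoiCell (hD.isGreatest_energy hf)

theorem IsPotential.energy_le_card_div_four (hf : G.IsPotential D f)
    (hD : G.IsAcyclicOrientation D) : G.energy f ≤ (D.card : ℝ) / 4 := by
  have hpotential := isPotential_iff_forall.1 hf f
  have hterm : ∑ e ∈ D, (f (G.head e) - f (G.tail e)) ≤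
      ∑ e ∈ D, ((f (G.head e) - f (G.tail e)) * (f (G.head e) - f (G.tail e)) + 1 / 4) :=
    Finset.sum_le_sum fun e _ => by nlinarith [sq_nonneg (f (G.head e) - f (G.tail e) - 1 / 2)]
  rw [Finset.sum_add_distrib, ← hD.dirichletForm_eq_sum, Finset.sum_const, nsmul_eq_mul] at hterm
  rw [energy_eq_dirichletForm]
  linarith

theorem Bipartite.exists_isWellUnbalanced_energy_eq (hG : G.Bipartite) :
    ∃ D f, G.IsWellUnbalanced D ∧ G.IsPotential D f ∧ G.energy f = (G.numEdges : ℝ) / 4 := by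
  classical
  obtain ⟨X, hX⟩ := hG
  have hloop : ∀ e, G.tail e ≠ G.head e := fun e he => iff_not_self (he ▸ hX e)
  let h : V → ℝ := fun v => if v ∈ X then -(1 / 4) else 1 / 4
  let D := G.increasingEdges h
  have hstep (e : A) : h (G.head e) - h (G.tail e) = if G.tail e ∈ X then 1 / 2 else -(1 / 2) := by
    have hhead : G.head e ∈ X ↔ G.tail e ∉ X := (not_iff_comm.1 (hX e).symm).symm
    by_cases htail : G.tail e ∈ X <;> norm_num [h, hhead, htail]
  have hD : G.IsAcyclicOrientation D := G.isAcyclicOrientation_increasingEdges fun e _ heq => by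
    have he := hstep e
    rw [heq, sub_self] at he
    split_ifs at he <;> norm_num at he
  have hdh : ∀ e ∈ D, h (G.head e) - h (G.tail e) = 1 / 2 := fun e he => by
    have hlt := G.mem_increasingEdges.1 he
    have hstep_e := hstep e
    split_ifs at hstep_e <;> linarith
  have hpotential : G.IsPotential D h := isPotential_iff_forall.2 fun g => by
    rw [hD.dirichletForm_eq_sum, Finset.mul_sum]
    exact Finset.sum_congr rfl fun e he => by rw [hdh e he]; ring
  have henergy : G.energy h = (G.numEdges : ℝ) / 4 := by
    rw [energy_eq_dirichletForm, hD.dirichletForm_eq_sum,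
      Finset.sum_congr rfl fun e he => by rw [hdh e he], Finset.sum_const, nsmul_eq_mul,
      hD.card_eq_numEdges hloop]
    ring
  refine ⟨D, h, ⟨hD, h, hpotential, fun D' f' hD' hf' => ?_⟩, hpotential, henergy⟩
  rw [henergy, ← hD'.card_eq_numEdges hloop]
  exact hf'.energy_le_card_div_four hD'

end WellUnbalanced

end OrGraph

theorem mainTheorem9_general {V A : Type*} [Fintype V] [Fintype A] [DecidableEq V]
    (G : OrGraph V A) :
    (∀ D : Finset A, (∃ f : V → ℝ, G.IsPotential D f) ∧
      ∀ f f' : V → ℝ, G.IsPotential D f → G.IsPotential D f' → G.energy f = G.energy f') ∧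
    (∃ D : Finset A, G.IsWellUnbalanced D) ∧
    (∀ D : Finset A, G.IsWellUnbalanced D → ∀ f : V → ℝ, G.IsPotential D f →
      IsCoveringNumber G.cutForm G.cutLattice (G.energy f)) ∧
    (G.Bipartite → IsCoveringNumber G.cutForm G.cutLattice ((G.numEdges : ℝ) / 4)) := by
  refine ⟨fun D => ⟨G.exists_isPotential D, fun _ _ => OrGraph.IsPotential.energy_eq⟩,
    G.exists_isWellUnbalanced, fun D hD f hf => hD.isCoveringNumber_energy hf, fun hB => ?_⟩
  obtain ⟨D, f, hD, hf, henergy⟩ := hB.exists_isWellUnbalanced_energy_eq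
  exact henergy ▸ hD.isCoveringNumber_energy hf

theorem mainTheorem9 {V A : Type*} [Fintype V] [Fintype A] [DecidableEq V]
    (G : OrGraph V A) (hG : G.Connected) :
    (∀ D : Finset A, G.IsAcyclicOrientation D →
      (∃ f : V → ℝ, G.IsPotential D f) ∧
      ∀ f f' : V → ℝ, G.IsPotential D f → G.IsPotential D f' → G.energy f = G.energy f') ∧
    (∃ D : Finset A, G.IsWellUnbalanced D) ∧
    (∀ D : Finset A, G.IsWellUnbalanced D → ∀ f : V → ℝ, G.IsPotential D f →
      IsCoveringNumber G.cutForm G.cutLattice (G.energy f)) ∧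
    (G.Bipartite → IsCoveringNumber G.cutForm G.cutLattice ((G.numEdges : ℝ) / 4)) :=
  ⟨fun D _ => (mainTheorem9_general G).1 D, (mainTheorem9_general G).2⟩
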